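/- **Notation.** For a binary word $x$ let $\mathcal D_t(x)$ be the set of words obtained from $x$ by deleting exactly $t$ symbols. Let $N_0(x),N_1(x)$ be the numbers of zeros and ones in $x$, and for a binary word $w$ let $N_w(x)$ be the number of (possibly overlapping) occurrences of $w$ in $x$ as a block of consecutive symbols. If $w$ occurs $k$ times in $x$, these occurrences delimit $k+1$ substrings $u_0,\dots,u_k$ of $x$: the one before the first occurrence, those between consecutive occurrences (the null string if the two occurrences overlap or touch), and the one after the last occurrence ($u_0=x$ if $k=0$). Put $L(x,w)=\max_i|u_i|$, and for a function $h$ put $F_h(x,w)=(h(u_0),\dots,h(u_k))$. **Construction.** Let $n,s\ge 0$ be integers. Let $h_s$ be a hash function from the binary words of length at most $s$ to $\{0,1\}^v$ such that every word $u$ of length at most $s$ can be recovered from $h_s(u)$ and any word obtained from $u$ by at most two deletions; that is, if $|u|,|u'|\le s$, $h_s(u)=h_s(u')$, and some word lies in both $\bigcup_{t\le 2}\mathcal D_t(u)$ and $\bigcup_{t\le 2}\mathcal D_t(u')$, then $u=u'$. Let $q$ be an odd prime greater than the size of the image of $h_s$ (for instance the smallest one), and regard the values of $h_s$ as elements of $\mathbb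 F_q$ through an arbitrary injection of the image into $\mathbb F_q$. Let $N\ge1$ be an integer with $q^{N-1}>n$ (for instance the smallest one), and let $H\in\mathbb F_q^{\,r\times q^{N-1}}$ be a parity check matrix of a linear code of minimum Hamming distance at least $5$, i.e. every nonzero $z$ with $Hz=0$ has at least $5$ nonzero entries. For $a\in\mathbb F_q^{\,r}$ put $\mathcal C_2(n,q,a)=\{z\in\mathbb F_q^{\,q^{N-1}}: Hz=a\}$; a shorter sequence over $\mathbb F_q$ is said to lie in $\mathcal C_2(n,q,a)$ if it does so after being extended by zeros to length $q^{N-1}$. For $a_{0000},a_{1111},a_{110011},a_{11011}\in\mathbb F_q^{\,r}$ and $c=(c_1,\dots,c_6)\in\mathbb F_7^6$ let $\mathcal C(n,a_{0000},a_{1111},a_{110011},a_{11011},c,s)$ be the set of all $x\in\{0,1\}^n$ such that - $L(x,w)\le s$ for each $w\in\{0000,1111,110011,11011\}$; - $N_0(x)\equiv c_1$, $N_1(x)\equiv c_2$, $N_{1111}(x)\equiv c_3$, $N_{0000}(x)\equiv c_4$, $N_{110011}(x)\equiv c_5$, $N_{11011}(x)\equiv c_6 \pmod 7$; - $F_{h_s}(x,w)\in\mathcal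 C_2(n,q,a_w)$ for each $w\in\{0000,1111,110011,11011\}$. **Theorem.** The code $\mathcal C(n,a_{0000},a_{1111},a_{110011},a_{11011},c,s)$ can correct two deletions: if $x,x'$ are codewords and $\mathcal D_2(x)\cap\mathcal D_2(x')\neq\emptyset$, then $x=x'$. -/

import Mathlib

namespace TwoDeletion

/-- Binary words; `false` is the symbol `0` and `true` is the symbol `1`. -/
abbrev Word := List Bool

/-- The words that result from `x` by deleting exactly `t` of its symbols. -/
def deletionBall (t : ℕ) (x : Word) : Set Word :=
  {y | y.Sublist x ∧ y.length + t = x.length}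

/-- A set of words of one common length corrects two deletions if no word can arise from two
different codewords by deleting two symbols, i.e. `y ∈ D₂(x)` determines the codeword `x`. -/
def CorrectsTwoDeletions (C : Set Word) : Prop :=
  ∀ x ∈ C, ∀ x' ∈ C, ∀ y, y ∈ deletionBall 2 x → y ∈ deletionBall 2 x' → x = x'

/-- The starting positions (counted from `0`, increasing) of all occurrences of `w` in `x`, as
consecutive symbols; occurrences may overlap. -/
def occurrences (w x : Word) : List ℕ :=
  (List.range (x.length + 1)).filter fun i => w.isPrefixOf (x.drop i)

/-- The number of occurrences of `w` in `x`. -/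
def numOcc (w x : Word) : ℕ := (occurrences w x).length

/-- The `k + 1` substrings into which the `k` occurrences of `w` divide `x`: the one before the
first occurrence, those between consecutive occurrences (the null string if these overlap or
touch), and the one after the last occurrence. It is `[x]` if `w` does not occur. -/
def segments (w x : Word) : List Word :=
  List.zipWith (fun a b => (x.take b).drop a)
    (0 :: (occurrences w x).map (· + w.length)) (occurrences w x ++ [x.length])

/-- `L(x, w)`, the largest length of a substring of `x` delimited by the occurrences of `w`. -/
def maxGap (w x : Word) : ℕ := ((segments w x).map List.length).foldr max 0

/-- `F_h(x, w)`, the sequence of the hashes of the substrings delimited by `w`. -/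
def hashSeq {α : Type*} (h : Word → α) (w x : Word) : List α := (segments w x).map h

/-- A sequence, extended by zeros to a vector of length `m`. -/
def padZero {q : ℕ} (m : ℕ) (l : List (ZMod q)) : Fin m → ZMod q := fun i => l.getD i 0

/-- The defining property of the hash function `h_s` on the words of length at most `s`: a word
`u` can be recovered from `h u` together with any word that results from `u` by at most two
deletions. -/
def IsTwoDeletionHash {α : Type*} (s : ℕ) (h : Word → α) : Prop :=
  ∀ u u' z : Word, u.length ≤ s → u'.length ≤ s →
    (∃ t ≤ 2, z ∈ deletionBall t u) → (∃ t ≤ 2, z ∈ deletionBall t u') →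
    h u = h u' → u = u'

/-- `H` is a parity check matrix of a linear code with minimum Hamming distance at least `5`. -/
def IsDoubleErrorCorrecting {q r m : ℕ} (H : Matrix (Fin r) (Fin m) (ZMod q)) : Prop :=
  ∀ z : Fin m → ZMod q, H.mulVec z = 0 → z ≠ 0 → 5 ≤ hammingNorm z

/-- The coset `{z : H z = a}` of the code with parity check matrix `H`. -/
def cosetCode {q r m : ℕ} (H : Matrix (Fin r) (Fin m) (ZMod q)) (a : Fin r → ZMod q) :
    Set (Fin m → ZMod q) :=
  {z | H.mulVec z = a}

def w0000 : Word := [false, false, false, false]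
def w1111 : Word := [true, true, true, true]
def w110011 : Word := [true, true, false, false, true, true]
def w11011 : Word := [true, true, false, true, true]

/-- `C_T(n, s)`, the words of length `n` with all gaps at most `s`. -/
def constrainedWords (n s : ℕ) : Set Word :=
  {x | x.length = n ∧ maxGap w0000 x ≤ s ∧ maxGap w1111 x ≤ s ∧
    maxGap w110011 x ≤ s ∧ maxGap w11011 x ≤ s}

/-- The code `C(n, a₀₀₀₀, a₁₁₁₁, a₁₁₀₀₁₁, a₁₁₀₁₁, c, s)`, for a hash `g` with values in `𝔽_q` and
a parity check matrix `H`. -/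
def code {q r m : ℕ} (n s : ℕ) (g : Word → ZMod q) (H : Matrix (Fin r) (Fin m) (ZMod q))
    (a0000 a1111 a110011 a11011 : Fin r → ZMod q) (c : Fin 6 → ZMod 7) : Set Word :=
  {x | x ∈ constrainedWords n s ∧
    (x.count false : ZMod 7) = c 0 ∧
    (x.count true : ZMod 7) = c 1 ∧
    (numOcc w1111 x : ZMod 7) = c 2 ∧
    (numOcc w0000 x : ZMod 7) = c 3 ∧
    (numOcc w110011 x : ZMod 7) = c 4 ∧
    (numOcc w11011 x : ZMod 7) = c 5 ∧
    padZero m (hashSeq g w0000 x) ∈ cosetCode H a0000 ∧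
    padZero m (hashSeq g w1111 x) ∈ cosetCode H a1111 ∧
    padZero m (hashSeq g w110011 x) ∈ cosetCode H a110011 ∧
    padZero m (hashSeq g w11011 x) ∈ cosetCode H a11011}

end TwoDeletion

/-! Call 0000, 1111, 110011 and 11011 markers. If two deletions preserve all occurrences of a marker
and their overlaps (`InnerDel`), they only shorten segments, at most two of them. For two codewords
with a common subword `y`, the hash sequences then differ in at most four places, so minimum
distance 5 makes them equal and the hashes return the segments (`segments_eq_of_listDel`). Segments
and overlaps determine the word (`eq_of_segments_eq`). It remains to find one marker preserved for
both codewords.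

Deleting a 0 either lowers N_0000 by one and preserves the other three markers, or preserves 0000
and raises N_1111 by one to three, or preserves both; deleting a 1 acts on 0000 and 1111 with the
roles exchanged (`delete_zero_cases`, `delete_one_cases`). The counts modulo 7 fix how many symbols
of each kind are deleted and the exact changes of N_0000 and N_1111. If just one of these counts
changes, the other marker is the preserved one. If neither changes, opposite effects may have
cancelled, and the two codewords may preserve different markers; if both change, 0000 and 1111 are
both damaged. Then 11011 or 110011 decides.

One defect remains: a 1 deleted between two touching copies of a long marker alters an overlap but
no segment. The total segment length then exceeds that of `y` by one instead of two, which tells the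
codewords apart (`Decodes.ne_left`). -/

namespace TwoDeletion

/-! ### Reconstruction of a word from its segments and overlaps. -/

/-- The pairs of end points of the substrings delimited by occurrences of a word of length `m` at
the positions `O` in a word of length `len`, when the first substring starts at `a`. -/
def gaps (m : ℕ) : ℕ → List ℕ → ℕ → List (ℕ × ℕ)
  | a, [], len => [(a, len)]
  | a, o :: O, len => (a, o) :: gaps m (o + m) O len

/-- The factor of `x` between two positions. -/
def slice (x : Word) (g : ℕ × ℕ) : Word := (x.take g.2).drop g.1

/-- The lengths of the overlaps of consecutive occurrences of `w` in `x`. -/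
def overlaps (w x : Word) : List ℕ :=
  (gaps w.length 0 (occurrences w x) x.length).map fun g => g.1 - g.2

theorem zipWith_eq_map_gaps {α : Type*} (f : ℕ → ℕ → α) (m a len : ℕ) (O : List ℕ) :
    List.zipWith f (a :: O.map (· + m)) (O ++ [len]) =
      (gaps m a O len).map fun g => f g.1 g.2 := by
  induction O generalizing a with
  | nil => simp [gaps]
  | cons o O ih => simpa [gaps] using ih (o + m)

theorem segments_eq (w x : Word) :
    segments w x = (gaps w.length 0 (occurrences w x) x.length).map (slice x) :=
  zipWith_eq_map_gaps _ _ _ _ _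

theorem length_gaps (m a len : ℕ) (O : List ℕ) : (gaps m a O len).length = O.length + 1 := by
  induction O generalizing a with
  | nil => simp [gaps]
  | cons o O ih => simp [gaps, ih]

theorem length_segments (w x : Word) : (segments w x).length = numOcc w x + 1 := by
  simp [segments_eq, length_gaps, numOcc]

theorem mem_occurrences {w x : Word} {i : ℕ} :
    i ∈ occurrences w x ↔ i ≤ x.length ∧ w <+: x.drop i := by
  simp [occurrences]

theorem add_length_le_of_prefix_drop {w x : Word} (hw : w ≠ []) {i : ℕ} (h : w <+: x.drop i) :
    i + w.length ≤ x.length := by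
  have h1 := h.length_le
  have h2 := List.length_pos_of_ne_nil hw
  rw [List.length_drop] at h1
  omega

theorem length_segments_le {w x : Word} (hw : w ≠ []) : (segments w x).length ≤ x.length + 1 := by
  -- The position `x.length` can only carry the empty word. Without it there are at most `x.length +
  -- 1` segments, so their hashes fit into a vector of length greater than `x.length`.
  have h1 : occurrences w x = (List.range x.length).filter fun i => w.isPrefixOf (x.drop i) := by
    rw [occurrences, List.range_succ, List.filter_append]
    simp [hw]
  rw [length_segments, numOcc, h1]
  have := List.length_filter_le (fun i => w.isPrefixOf (x.drop i)) (List.range x.length)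
  simp only [List.length_range] at this
  omega

theorem length_slice (x : Word) (g : ℕ × ℕ) : (slice x g).length = min g.2 x.length - g.1 := by
  simp [slice]

theorem eq_of_map_slice_gaps {w : Word} (hw : w ≠ []) {x x' : Word} (hx : x.length = x'.length)
    (O O' : List ℕ) (a : ℕ) (hO : ∀ o ∈ O, w <+: x.drop o) (hO' : ∀ o ∈ O', w <+: x'.drop o)
    (ha : x.take a = x'.take a)
    (hs : (gaps w.length a O x.length).map (slice x) =
      (gaps w.length a O' x.length).map (slice x'))
    (ho : (gaps w.length a O x.length).map (fun g => g.1 - g.2) =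
      (gaps w.length a O' x.length).map (fun g => g.1 - g.2)) : x = x' := by
  induction O generalizing a O' with
  | nil =>
    cases O' with
    | nil =>
      simp only [gaps, List.map_cons, List.map_nil, List.cons.injEq, and_true, slice] at hs
      rw [List.take_length, hx, List.take_length] at hs
      rw [← List.take_append_drop a x, ← List.take_append_drop a x', ha, hs]
    | cons o' O' =>
      have := congrArg List.length hs
      simp [gaps, length_gaps] at this
  | cons o O ih =>
    cases O' with
    | nil =>
      have := congrArg List.length hs
      simp [gaps, length_gaps] at this
    | cons o' O' =>
      simp only [gaps, List.map_cons, List.cons.injEq] at hs ho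
      have h1 := add_length_le_of_prefix_drop hw (hO o (by simp))
      have h2 := add_length_le_of_prefix_drop hw (hO' o' (by simp))
      have h3 := congrArg List.length hs.1
      simp only [length_slice] at h3
      -- The segment length gives the truncated difference `o - a`, the overlap gives `a - o`;
      -- together they fix `o`.
      have h4 : o = o' := by omega
      subst h4
      have h5 : x.take o = x'.take o := by
        rcases le_total o a with h | h
        · have := congrArg (List.take o) ha
          simpa [List.take_take, h] using this
        · have e : ∀ z : Word, z.take o = z.take a ++ slice z (a, o) := by
            intro z
            have := List.take_append_drop a (z.take o)
            rw [List.take_take, min_eq_left h] at this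
            exact this.symm
          rw [e x, e x', ha, hs.1]
      refine ih O' (o + w.length) (fun i hi => hO i (by simp [hi]))
        (fun i hi => hO' i (by simp [hi])) ?_ hs.2 ho.2
      have e1 := List.prefix_iff_eq_take.1 (hO o (by simp))
      have e2 := List.prefix_iff_eq_take.1 (hO' o (by simp))
      rw [List.take_add, List.take_add, ← e1, ← e2, h5]

/-- A word is determined by the substrings that the occurrences of `w` delimit, together with the
overlaps of these occurrences. -/
theorem eq_of_segments_eq {w : Word} (hw : w ≠ []) {x x' : Word} (hx : x.length = x'.length)
    (hs : segments w x = segments w x') (ho : overlaps w x = overlaps w x') : x = x' := by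
  rw [segments_eq, segments_eq, ← hx] at hs
  rw [overlaps, overlaps, ← hx] at ho
  exact eq_of_map_slice_gaps hw hx _ _ 0 (fun o h => (mem_occurrences.1 h).2)
    (fun o h => (mem_occurrences.1 h).2) rfl hs ho

/-! ### Deletions spread over a list of segments, and decoding of the hashes. -/

/-- `l'` arises from the list of words `l` by deleting `t` symbols in all. -/
def ListDel (t : ℕ) (l' l : List Word) : Prop :=
  List.Forall₂ List.Sublist l' l ∧ (l.map List.length).sum = (l'.map List.length).sum + t

theorem ListDel.refl (l : List Word) : ListDel 0 l l :=
  ⟨List.forall₂_same.2 fun _ _ => List.Sublist.refl _, rfl⟩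

theorem ListDel.trans {s t : ℕ} {l₁ l₂ l₃ : List Word} (h : ListDel s l₁ l₂)
    (h' : ListDel t l₂ l₃) : ListDel (s + t) l₁ l₃ := by
  refine ⟨?_, by have := h.2; have := h'.2; omega⟩
  obtain ⟨h1, -⟩ := h
  obtain ⟨h2, -⟩ := h'
  induction h1 generalizing l₃ with
  | nil => exact h2
  | cons a _ ih =>
    cases h2 with
    | cons b hb => exact List.Forall₂.cons (a.trans b) (ih hb)

theorem ListDel.cons {t : ℕ} {l' l : List Word} (u : Word) (h : ListDel t l' l) :
    ListDel t (u :: l') (u :: l) :=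
  ⟨List.Forall₂.cons (List.Sublist.refl u) h.1, by have := h.2; simp; omega⟩

theorem sum_length_le_of_forall₂ {l' l : List Word} (h : List.Forall₂ List.Sublist l' l) :
    (l'.map List.length).sum ≤ (l.map List.length).sum := by
  induction h with
  | nil => simp
  | cons h _ ih => have := h.length_le; simp; omega

theorem ListDel.deletionBall {t : ℕ} {l' l : List Word} (h : ListDel t l' l) {i : ℕ}
    (hi : i < l.length) (hi' : i < l'.length) : ∃ s ≤ t, l'[i] ∈ deletionBall s l[i] := by
  obtain ⟨h1, h2⟩ := h
  induction h1 generalizing i t with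
  | nil => simp at hi
  | @cons a b l₁ l₂ hab hl ih =>
    have e1 := hab.length_le
    have e2 := sum_length_le_of_forall₂ hl
    simp only [List.map_cons, List.sum_cons] at h2
    cases i with
    | zero => exact ⟨b.length - a.length, by omega, hab, by simp; omega⟩
    | succ i =>
      obtain ⟨s, hs, h⟩ := ih (i := i) (t := t - (b.length - a.length)) (by simpa using hi)
        (by simpa using hi') (by omega)
      exact ⟨s, by omega, by simpa using h⟩

/-- A sublist of full length is the whole word, so each changed entry uses up at least one of the
`t` deletions. -/
theorem ListDel.card_ne_le {t : ℕ} {l' l : List Word} (h : ListDel t l' l) :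
    ((Finset.range l.length).filter fun i => l'[i]? ≠ l[i]?).card ≤ t := by
  obtain ⟨h1, h2⟩ := h
  induction h1 generalizing t with
  | nil => simp
  | @cons a b l₁ l₂ hab hl ih =>
    have e1 := hab.length_le
    have e2 := sum_length_le_of_forall₂ hl
    simp only [List.map_cons, List.sum_cons] at h2
    have e3 := ih (t := t - (b.length - a.length)) (by omega)
    simp only [Finset.card_filter] at e3 ⊢
    rw [List.length_cons, Finset.sum_range_succ']
    simp only [List.getElem?_cons_succ, List.getElem?_cons_zero]
    split_ifs with hne
    · have : a.length ≠ b.length := fun e => hne (by rw [hab.eq_of_length e])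
      omega
    · omega

theorem eq_of_mem_cosetCode {q r m : ℕ} {H : Matrix (Fin r) (Fin m) (ZMod q)}
    (hH : IsDoubleErrorCorrecting H) {a : Fin r → ZMod q} {z z' : Fin m → ZMod q}
    (hz : z ∈ cosetCode H a) (hz' : z' ∈ cosetCode H a) (h : hammingDist z z' ≤ 4) : z = z' := by
  by_contra hne
  have h1 : H.mulVec (z - z') = 0 := by
    rw [Matrix.mulVec_sub, hz, hz', sub_self]
  have h2 := hH _ h1 (sub_ne_zero.2 hne)
  rw [hammingDist_comm, hammingDist_eq_hammingNorm, neg_add_eq_sub] at h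
  omega

theorem length_le_of_mem_segments {w x u : Word} {s : ℕ} (h : maxGap w x ≤ s)
    (hu : u ∈ segments w x) : u.length ≤ s := by
  refine le_trans ?_ h
  rw [maxGap]
  have : u.length ∈ (segments w x).map List.length := List.mem_map_of_mem hu
  generalize (segments w x).map List.length = l at this
  induction l with
  | nil => simp at this
  | cons b l ih =>
    rcases List.mem_cons.1 this with h | h
    · simp [h]
    · exact le_trans (ih h) (by simp)

/-- Decoding of the hash sequence: the substrings delimited by `w` are determined. -/
theorem segments_eq_of_listDel {q r m s t t' : ℕ} {g : Word → ZMod q}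
    (hg : IsTwoDeletionHash s g) {H : Matrix (Fin r) (Fin m) (ZMod q)}
    (hH : IsDoubleErrorCorrecting H) {a : Fin r → ZMod q} {w x x' y : Word} (hw : w ≠ [])
    (hxm : x.length < m) (hL : maxGap w x ≤ s) (hL' : maxGap w x' ≤ s)
    (hc : padZero m (hashSeq g w x) ∈ cosetCode H a)
    (hc' : padZero m (hashSeq g w x') ∈ cosetCode H a) (ht : t ≤ 2) (ht' : t' ≤ 2)
    (h : ListDel t (segments w y) (segments w x))
    (h' : ListDel t' (segments w y) (segments w x')) : segments w x = segments w x' := by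
  have l1 := h.1.length_eq
  have l2 := h'.1.length_eq
  have l3 := length_segments_le (x := x) hw
  -- The segments of `x` and of `x'` each differ from those of `y` at two indices at most, hence the
  -- distance is at most 4. Beyond the last segment both vectors hold the padding 0.
  have key : padZero m (hashSeq g w x) = padZero m (hashSeq g w x') := by
    refine eq_of_mem_cosetCode hH hc hc' ?_
    have c1 := h.card_ne_le
    have c2 := h'.card_ne_le
    rw [← l1] at c1
    rw [← l2] at c2
    have c3 := Finset.card_union_le
      ((Finset.range (segments w y).length).filter fun i =>
        (segments w y)[i]? ≠ (segments w x)[i]?)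
      ((Finset.range (segments w y).length).filter fun i =>
        (segments w y)[i]? ≠ (segments w x')[i]?)
    refine le_trans ?_ (c3.trans (by omega))
    rw [hammingDist]
    refine Finset.card_le_card_of_injOn (fun i => (i : ℕ)) ?_ (by intro i _ j _ e; exact Fin.ext e)
    intro i hi
    simp only [Finset.coe_filter, Finset.mem_univ, true_and, Set.mem_ofPred_eq] at hi
    by_contra hn
    simp only [Finset.coe_union, Finset.coe_filter, Set.mem_union, Set.mem_ofPred_eq,
      Finset.mem_range, not_or, not_and, not_not] at hn
    apply hi
    simp only [padZero, hashSeq, List.getD_eq_getElem?_getD, List.getElem?_map]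
    by_cases hlt : (i : ℕ) < (segments w y).length
    · rw [← hn.1 hlt, ← hn.2 hlt]
    · rw [List.getElem?_eq_none (by omega), List.getElem?_eq_none (by omega)]
  refine List.ext_getElem (by omega) fun i hi hi' => ?_
  obtain ⟨d, hd, hb⟩ := h.deletionBall hi (by omega)
  obtain ⟨d', hd', hb'⟩ := h'.deletionBall hi' (by omega)
  refine hg _ _ _ (length_le_of_mem_segments hL (List.getElem_mem hi))
    (length_le_of_mem_segments hL' (List.getElem_mem hi')) ⟨d, by omega, hb⟩ ⟨d', by omega, hb'⟩ ?_
  have := congrFun key ⟨i, by omega⟩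
  simpa [padZero, hashSeq, List.getD_eq_getElem?_getD, hi, hi'] using this

/-! ### Deletions that preserve every occurrence of a marker. -/

theorem prefix_append_iff {w u t : Word} :
    w <+: u ++ t ↔
      w <+: u ∨ (u.length < w.length ∧ w.take u.length = u ∧ w.drop u.length <+: t) := by
  constructor
  · intro h
    rcases le_or_gt w.length u.length with hl | hl
    · exact Or.inl (List.prefix_of_prefix_length_le h (List.prefix_append u t) hl)
    · obtain ⟨r, rfl⟩ := List.prefix_of_prefix_length_le (List.prefix_append u t) h hl.le
      refine Or.inr ⟨hl, by simp, ?_⟩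
      simpa [List.prefix_append_right_inj] using h
  · rintro (h | ⟨-, h1, h2⟩)
    · exact List.prefix_append_of_prefix h
    · rw [← List.take_append_drop u.length w, h1]
      exact (List.prefix_append_right_inj u).2 h2

/-- No occurrence of `w` in `A ++ T` lies across the boundary between `A` and `T`. -/
def NoCross (w A T : Word) : Prop :=
  ∀ j, 0 < j → j < w.length → w.take j <:+ A → ¬ w.drop j <+: T

theorem NoCross.prefix_drop_iff {w A T : Word} (h : NoCross w A T) {i : ℕ} (hi : i < A.length) :
    w <+: (A ++ T).drop i ↔ w <+: A.drop i := by
  rw [List.drop_append_of_le_length hi.le, prefix_append_iff]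
  refine or_iff_left ?_
  rintro ⟨h1, h2, h3⟩
  refine h _ ?_ h1 ?_ h3
  · simpa using hi
  · rw [h2]
    exact List.drop_suffix _ _

theorem occurrences_append (w A T : Word) :
    occurrences w (A ++ T) =
      ((List.range A.length).filter fun i => w.isPrefixOf ((A ++ T).drop i)) ++
        (occurrences w T).map (A.length + ·) := by
  rw [occurrences, List.length_append, Nat.add_assoc, List.range_add, List.filter_append,
    List.filter_map, occurrences]
  congr 2
  refine List.filter_congr fun i _ => ?_
  rw [Function.comp_apply, List.drop_length_add_append]

theorem NoCross.occurrences_append {w A T : Word} (h : NoCross w A T) :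
    occurrences w (A ++ T) =
      ((List.range A.length).filter fun i => w.isPrefixOf (A.drop i)) ++
        (occurrences w T).map (A.length + ·) := by
  rw [TwoDeletion.occurrences_append]
  congr 1
  refine List.filter_congr fun i hi => ?_
  rw [Bool.eq_iff_iff, List.isPrefixOf_iff_prefix, List.isPrefixOf_iff_prefix]
  exact h.prefix_drop_iff (by simpa using hi)

theorem occurrences_cons (w T : Word) (b : Bool) :
    occurrences w (b :: T) =
      (if w.isPrefixOf (b :: T) then [0] else []) ++ (occurrences w T).map (1 + ·) := by
  have := occurrences_append w [b] T
  simpa [List.range_succ, List.filter_cons] using this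

theorem slice_succ_succ (A B : Word) (b : Bool) {g : ℕ × ℕ} (hg : A.length ≤ g.1) :
    slice (A ++ b :: B) (g.1 + 1, g.2 + 1) = slice (A ++ B) g := by
  obtain ⟨k, hk⟩ := Nat.exists_eq_add_of_le hg
  simp only [slice, List.drop_take]
  rw [hk, Nat.add_assoc, List.drop_length_add_append, List.drop_length_add_append,
    List.drop_succ_cons, ← Nat.add_assoc, Nat.add_sub_add_right]

theorem slice_of_le (A T T' : Word) {g : ℕ × ℕ} (hg : g.2 ≤ A.length) :
    slice (A ++ T) g = slice (A ++ T') g := by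
  rw [slice, slice, List.take_append_of_le_length hg, List.take_append_of_le_length hg]

theorem slice_sublist (A B : Word) (b : Bool) {a c : ℕ} (ha : a ≤ A.length) (hc : A.length ≤ c) :
    (slice (A ++ B) (a, c)).Sublist (slice (A ++ b :: B) (a, c + 1)) := by
  obtain ⟨k, rfl⟩ := Nat.exists_eq_add_of_le hc
  have h1 : (A ++ b :: B).take (A.length + k + 1) = A ++ b :: B.take k := by
    rw [Nat.add_assoc, List.take_length_add_append, List.take_succ_cons]
  rw [slice, slice, h1, List.take_length_add_append, List.drop_append_of_le_length ha,
    List.drop_append_of_le_length ha]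
  exact List.Sublist.append_left (List.sublist_cons_self _ _) _

theorem gaps_map_succ (m a len : ℕ) (R : List ℕ) :
    gaps m (a + 1) (R.map (· + 1)) (len + 1) =
      (gaps m a R len).map fun g => (g.1 + 1, g.2 + 1) := by
  induction R generalizing a with
  | nil => simp [gaps]
  | cons o R ih =>
    simp only [gaps, List.map_cons]
    rw [Nat.add_right_comm, ih]

theorem le_fst_of_mem_gaps {m a p len : ℕ} {R : List ℕ} (ha : p ≤ a) (hR : ∀ o ∈ R, p ≤ o) :
    ∀ g ∈ gaps m a R len, p ≤ g.1 := by
  induction R generalizing a with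
  | nil => simpa [gaps] using ha
  | cons o R ih =>
    intro g hg
    simp only [gaps, List.mem_cons] at hg
    rcases hg with rfl | hg
    · exact ha
    · exact ih (by have := hR o (by simp); omega) (fun i hi => hR i (by simp [hi])) g hg

theorem map_slice_gaps_succ (A B : Word) (b : Bool) {m a len : ℕ} {R : List ℕ}
    (ha : A.length ≤ a) (hR : ∀ o ∈ R, A.length ≤ o) :
    (gaps m (a + 1) (R.map (· + 1)) (len + 1)).map (slice (A ++ b :: B)) =
      (gaps m a R len).map (slice (A ++ B)) := by
  rw [gaps_map_succ, List.map_map]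
  exact List.map_congr_left fun g hg => slice_succ_succ A B b (le_fst_of_mem_gaps ha hR g hg)

theorem map_sub_gaps_succ (m a len : ℕ) (R : List ℕ) :
    (gaps m (a + 1) (R.map (· + 1)) (len + 1)).map (fun g => g.1 - g.2) =
      (gaps m a R len).map fun g => g.1 - g.2 := by
  rw [gaps_map_succ, List.map_map]
  exact List.map_congr_left fun g _ => by simp

/-- Every occurrence ends before the cut or starts after it, so exactly one gap contains the cut and
loses `b`; earlier gaps are untouched and later ones are shifted. -/
theorem listDel_gaps (A B : Word) (b : Bool) {m a : ℕ} {L R : List ℕ} (ha : a ≤ A.length)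
    (hL : ∀ o ∈ L, o + m ≤ A.length) (hR : ∀ o ∈ R, A.length ≤ o) :
    ListDel 1 ((gaps m a (L ++ R) (A ++ B).length).map (slice (A ++ B)))
      ((gaps m a (L ++ R.map (· + 1)) ((A ++ B).length + 1)).map (slice (A ++ b :: B))) := by
  have hlen : A.length ≤ (A ++ B).length := by simp
  induction L generalizing a with
  | nil =>
    cases R with
    | nil =>
      refine ⟨by simpa [gaps] using slice_sublist A B b ha hlen, ?_⟩
      simp [gaps, length_slice]
      omega
    | cons o R =>
      have ho := hR o (by simp)
      have hs := map_slice_gaps_succ A B b (m := m) (a := o + m) (len := (A ++ B).length) (R := R)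
        (by omega) (fun i hi => hR i (by simp [hi]))
      simp only [List.nil_append, List.map_cons, gaps]
      rw [Nat.add_right_comm, hs]
      refine ⟨List.Forall₂.cons (slice_sublist A B b ha ho)
        (List.forall₂_same.2 fun _ _ => List.Sublist.refl _), ?_⟩
      simp only [List.map_cons, List.sum_cons, length_slice, List.length_append, List.length_cons]
      omega
  | cons o L ih =>
    have ho := hL o (by simp)
    simp only [List.cons_append, gaps, List.map_cons]
    rw [slice_of_le A (b :: B) B (by simp; omega)]
    exact (ih ho fun i hi => hL i (by simp [hi])).cons _

/-- The gap around the cut `p` starts at or before `p` and ends at or after it, so its truncated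
difference is 0 on both sides; the other gaps move rigidly. -/
theorem overlaps_gaps {p len m a : ℕ} {L R : List ℕ} (ha : a ≤ p) (hp : p ≤ len)
    (hL : ∀ o ∈ L, o + m ≤ p) (hR : ∀ o ∈ R, p ≤ o) :
    (gaps m a (L ++ R.map (· + 1)) (len + 1)).map (fun g => g.1 - g.2) =
      (gaps m a (L ++ R) len).map fun g => g.1 - g.2 := by
  induction L generalizing a with
  | nil =>
    cases R with
    | nil => simp [gaps]; omega
    | cons o R =>
      have ho := hR o (by simp)
      have hs := map_sub_gaps_succ m (o + m) len R
      simp only [List.nil_append, List.map_cons, gaps]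
      rw [Nat.add_right_comm, hs]
      simp only [List.cons.injEq, and_true]
      omega
  | cons o L ih =>
    simp only [List.cons_append, gaps, List.map_cons]
    rw [ih (hL o (by simp)) fun i hi => hL i (by simp [hi])]

/-- `y` arises from `x` by `t` deletions inside the substrings delimited by `w`, all occurrences
of `w` and their overlaps being kept. -/
def InnerDel (t : ℕ) (w y x : Word) : Prop :=
  ListDel t (segments w y) (segments w x) ∧ overlaps w y = overlaps w x

theorem InnerDel.trans {s t : ℕ} {w x y z : Word} (h : InnerDel s w x y) (h' : InnerDel t w y z) :
    InnerDel (s + t) w x z :=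
  ⟨h.1.trans h'.1, h.2.trans h'.2⟩

theorem ListDel.numOcc_eq {t : ℕ} {w x y : Word}
    (h : ListDel t (segments w y) (segments w x)) : numOcc w y = numOcc w x := by
  have := h.1.length_eq
  rw [length_segments, length_segments] at this
  omega

theorem InnerDel.numOcc_eq {t : ℕ} {w x y : Word} (h : InnerDel t w y x) :
    numOcc w y = numOcc w x :=
  h.1.numOcc_eq

theorem innerDel_of_noCross {w A B : Word} {b : Bool} (hw : w ≠ [])
    (h1 : NoCross w A (b :: B)) (h2 : ¬ w <+: b :: B) (h3 : NoCross w A B) :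
    InnerDel 1 w (A ++ B) (A ++ b :: B) := by
  set L := (List.range A.length).filter fun i => w.isPrefixOf (A.drop i) with hLdef
  set R := (occurrences w B).map (A.length + ·) with hRdef
  have hL : ∀ o ∈ L, o + w.length ≤ A.length := by
    intro o ho
    simp only [hLdef, List.mem_filter, List.isPrefixOf_iff_prefix] at ho
    exact add_length_le_of_prefix_drop hw ho.2
  have hR : ∀ o ∈ R, A.length ≤ o := by
    intro o ho
    simp only [hRdef, List.mem_map] at ho
    obtain ⟨i, -, rfl⟩ := ho
    omega
  have ey : occurrences w (A ++ B) = L ++ R := h3.occurrences_append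
  have ex : occurrences w (A ++ b :: B) = L ++ R.map (· + 1) := by
    rw [h1.occurrences_append, occurrences_cons]
    simp only [List.isPrefixOf_iff_prefix, h2, if_false, List.nil_append, List.map_map, hRdef]
    congr 1
    exact List.map_congr_left fun i _ => by simp; omega
  have el : (A ++ b :: B).length = (A ++ B).length + 1 := by simp; omega
  constructor
  · rw [segments_eq, segments_eq, ex, ey, el]
    exact listDel_gaps A B b (Nat.zero_le _) hL hR
  · rw [overlaps, overlaps, ex, ey, el]
    exact (overlaps_gaps (Nat.zero_le _) (by simp) hL hR).symm

/-! ### A deletion at the junction of two touching occurrences. -/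

theorem map_slice_gaps_touching (A B : Word) (b : Bool) {m a c : ℕ} (hm : 0 < m)
    (hc : c + m = A.length) {O R : List ℕ} (hO : ∀ o ∈ O, o ≤ A.length)
    (hR : ∀ o ∈ R, A.length ≤ o) (len : ℕ) :
    (gaps m a (O ++ c :: (c + m) :: R.map (· + 1)) (len + 1)).map (slice (A ++ b :: B)) =
      (gaps m a (O ++ c :: (c + m - 1) :: R) len).map (slice (A ++ B)) := by
  induction O generalizing a with
  | nil =>
    have hs := map_slice_gaps_succ A B b (m := m) (a := c + m - 1 + m) (len := len) (R := R)
        (by omega) hR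
    simp only [List.nil_append, gaps, List.map_cons]
    rw [show c + m + m = c + m - 1 + m + 1 by omega, hs,
      slice_of_le A (b :: B) B (by simp; omega)]
    simp only [List.cons.injEq, true_and, and_true]
    -- Touching and overlapping occurrences both delimit the null string, so the segments do not see
    -- the change of overlap.
    rw [List.eq_nil_of_length_eq_zero (l := slice _ _) (by rw [length_slice]; simp),
      List.eq_nil_of_length_eq_zero (l := slice _ _) (by rw [length_slice]; simp)]
  | cons o O ih =>
    simp only [List.cons_append, gaps, List.map_cons]
    rw [ih fun i hi => hO i (by simp [hi]),
      slice_of_le A (b :: B) B (hO o (by simp))]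

/-- Deleting the first symbol of the second of two touching occurrences of `w`, when this leaves
two occurrences that overlap in one symbol. -/
theorem segments_eq_of_touching {w C A B : Word} {b : Bool} (hA : A = C ++ w) (hw : 1 < w.length)
    (h1 : NoCross w A (b :: B)) (h2 : w <+: b :: B)
    (h3 : ∀ j, 1 < j → j < w.length → w.take j <:+ A → ¬ w.drop j <+: B)
    (h4 : w.take 1 <:+ A) (h5 : w.drop 1 <+: B) :
    segments w (A ++ B) = segments w (A ++ b :: B) := by
  have hne : w ≠ [] := by rintro rfl; simp at hw
  have hlen : A.length = C.length + w.length := by simp [hA]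
  set R := (occurrences w B).map (A.length + ·) with hRdef
  have hR : ∀ o ∈ R, A.length ≤ o := by
    intro o ho
    simp only [hRdef, List.mem_map] at ho
    obtain ⟨i, -, rfl⟩ := ho
    omega
  set O := (List.range C.length).filter fun i => w.isPrefixOf (A.drop i) with hOdef
  have hO : ∀ o ∈ O, o ≤ A.length := by
    intro o ho
    simp only [hOdef, List.mem_filter, List.mem_range] at ho
    omega
  -- After position `C.length` fewer than `w.length` symbols of `A` remain, so no occurrence starts
  -- there. The value `k = w.length - 1` covers all of `A`, and `k = w.length - 2` omits its last
  -- position, where the new occurrence starts.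
  have hsplit : ∀ k, k < w.length →
      (List.range (C.length + 1 + k)).filter (fun i => w.isPrefixOf (A.drop i)) =
        O ++ [C.length] := by
    intro k hk
    rw [List.range_add, List.range_succ, List.filter_append, List.filter_append, hOdef]
    have e1 : w.isPrefixOf (A.drop C.length) = true := by simp [hA]
    have e2 : ((List.range k).map (C.length + 1 + ·)).filter
        (fun i => w.isPrefixOf (A.drop i)) = [] := by
      rw [List.filter_eq_nil_iff]
      intro i hi hp
      obtain ⟨l, -, rfl⟩ := List.mem_map.1 hi
      have := add_length_le_of_prefix_drop hne (List.isPrefixOf_iff_prefix.1 hp)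
      omega
    rw [e2]
    simp [e1]
  have ex : occurrences w (A ++ b :: B) =
      O ++ C.length :: (C.length + w.length) :: R.map (· + 1) := by
    rw [h1.occurrences_append, occurrences_cons, hlen,
      show C.length + w.length = C.length + 1 + (w.length - 1) by omega, hsplit _ (by omega)]
    simp only [List.isPrefixOf_iff_prefix, h2, if_true, List.map_map, hRdef, List.append_assoc,
      List.map_cons, List.cons_append, List.nil_append]
    congr 3
    exact List.map_congr_left fun i _ => by simp; omega
  have ey : occurrences w (A ++ B) = O ++ C.length :: (C.length + w.length - 1) :: R := by
    have e3 : (List.range A.length).filter (fun i => w.isPrefixOf ((A ++ B).drop i)) =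
        O ++ [C.length] ++ [C.length + w.length - 1] := by
      rw [← hsplit (w.length - 2) (by omega), hlen,
        show C.length + w.length = C.length + 1 + (w.length - 2) + 1 by omega, List.range_succ,
        List.filter_append]
      congr 1
      · refine List.filter_congr fun i hi => ?_
        rw [Bool.eq_iff_iff, List.isPrefixOf_iff_prefix, List.isPrefixOf_iff_prefix]
        have hi' : i < C.length + 1 + (w.length - 2) := by simpa using hi
        rw [List.drop_append_of_le_length (by omega), prefix_append_iff]
        refine or_iff_left ?_
        rintro ⟨f1, f2, f3⟩
        refine h3 _ ?_ f1 ?_ f3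
        · simp; omega
        · rw [f2]
          exact List.drop_suffix _ _
      · have e4 : w.isPrefixOf ((A ++ B).drop (C.length + 1 + (w.length - 2))) = true := by
          obtain ⟨D, hD⟩ := h4
          obtain ⟨E, hE⟩ := h5
          have hDl : D.length = C.length + 1 + (w.length - 2) := by
            have := congrArg List.length hD
            simp only [List.length_append, List.length_take] at this
            omega
          rw [← hDl, ← hD, List.append_assoc, List.drop_left, List.isPrefixOf_iff_prefix, ← hE,
            ← List.append_assoc, List.take_append_drop]
          exact List.prefix_append _ _
        simp [e4]
    rw [occurrences_append, e3]
    simp [hRdef]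
  have el : (A ++ b :: B).length = (A ++ B).length + 1 := by simp; omega
  rw [segments_eq, segments_eq, ex, ey, el]
  exact (map_slice_gaps_touching A B b (by omega) hlen.symm hO hR _).symm

/-! ### Counting the occurrences lost and created by one deletion. -/

/-- The number of occurrences of `w` across the boundary between `r.reverse` and `t`. -/
def crossCount (w r t : Word) : ℕ :=
  (List.range (w.length - 1)).countP fun j =>
    (w.take (j + 1)).reverse.isPrefixOf r && (w.drop (j + 1)).isPrefixOf t

/-- The number of occurrences of `w` in `r.reverse ++ b :: t` that contain the symbol `b`. -/
def lossCount (w : Word) (b : Bool) (r t : Word) : ℕ :=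
  crossCount w r (b :: t) + if w.isPrefixOf (b :: t) then 1 else 0

theorem countP_range_eq_add {p p' : ℕ → Bool} {k n : ℕ} (h : ∀ j < n, j ≠ k → p j = p' j)
    (hk : p' k = false) :
    (List.range n).countP p = (List.range n).countP p' + if k < n ∧ p k then 1 else 0 := by
  induction n with
  | zero => simp
  | succ n ih =>
    rw [List.range_succ, List.countP_append, List.countP_append,
      ih fun j hj => h j (by omega)]
    simp only [List.countP_singleton]
    rcases eq_or_ne n k with rfl | hn
    · simp [hk]
    · rw [h n (by omega) hn]
      have : k < n + 1 ↔ k < n := by omega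
      simp only [this]
      omega

theorem numOcc_cons (w T : Word) (b : Bool) :
    numOcc w (b :: T) = (if w.isPrefixOf (b :: T) then 1 else 0) + numOcc w T := by
  rw [numOcc, occurrences_cons, numOcc]
  split_ifs <;> simp [Nat.add_comm]

theorem numOcc_nil {w : Word} (hw : w ≠ []) : numOcc w [] = 0 := by
  simp [numOcc, occurrences, List.range_succ, hw]

/-- A suffix of `a :: A` is a suffix of `A` or the whole word, so the only new crossing occurrence
is one that starts at `a`. -/
theorem crossCount_cons (w A T : Word) (a : Bool) :
    crossCount w (a :: A).reverse T = crossCount w A.reverse T +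
      if (a :: A).length < w.length ∧ w.take (a :: A).length = a :: A ∧
        w.drop (a :: A).length <+: T then 1 else 0 := by
  have hlen : ∀ j, j < w.length - 1 → (w.take (j + 1)).length = j + 1 := fun j hj => by
    simp; omega
  rcases le_or_gt (w.length - 1) A.length with hA | hA
  · rw [if_neg (by simp; omega), crossCount, crossCount]
    refine List.countP_congr fun j hj => ?_
    have hj' := List.mem_range.1 hj
    simp only [Bool.and_eq_true, List.isPrefixOf_iff_prefix, List.reverse_prefix,
      List.suffix_cons_iff]
    have : w.take (j + 1) ≠ a :: A := fun e => by
      have := congrArg List.length e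
      rw [hlen j hj', List.length_cons] at this
      omega
    simp [this]
  · rw [crossCount, crossCount, countP_range_eq_add (k := A.length)
      (p' := fun j => (w.take (j + 1)).reverse.isPrefixOf A.reverse &&
        (w.drop (j + 1)).isPrefixOf T)]
    · have hsuf : w.take (A.length + 1) <:+ a :: A ↔ w.take (A.length + 1) = a :: A :=
        ⟨fun h => h.eq_of_length (by rw [hlen _ hA, List.length_cons]), fun h => by rw [h]⟩
      simp only [Bool.and_eq_true, List.isPrefixOf_iff_prefix, List.reverse_prefix, hsuf,
        List.length_cons, hA, true_and, show A.length + 1 < w.length by omega]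
    · intro j hj hjA
      rw [Bool.eq_iff_iff]
      simp only [Bool.and_eq_true, List.isPrefixOf_iff_prefix,
        List.reverse_prefix, List.suffix_cons_iff]
      have : w.take (j + 1) ≠ a :: A := fun e => by
        have := congrArg List.length e
        rw [hlen j hj, List.length_cons] at this
        omega
      simp [this]
    · rw [Bool.eq_false_iff]
      intro h
      rw [Bool.and_eq_true, List.isPrefixOf_iff_prefix, List.reverse_prefix] at h
      have := h.1.length_le
      rw [hlen _ hA] at this
      omega

theorem numOcc_append {w : Word} (hw : w ≠ []) (A T : Word) :
    numOcc w (A ++ T) = numOcc w A + crossCount w A.reverse T + numOcc w T := by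
  induction A with
  | nil =>
    have : crossCount w [] T = 0 := by
      rw [crossCount, List.countP_eq_zero]
      intro j hj
      simp [hw]
    simp [numOcc_nil hw, this]
  | cons a A ih =>
    rw [List.cons_append, numOcc_cons, ih, numOcc_cons, crossCount_cons, ← List.cons_append]
    simp only [List.isPrefixOf_iff_prefix, prefix_append_iff (u := a :: A)]
    have := @List.IsPrefix.length_le _ w (a :: A)
    split_ifs <;> first | omega | (exfalso; grind)

theorem noCross_of_crossCount {w A T : Word} (h : crossCount w A.reverse T = 0) :
    NoCross w A T := by
  intro j hj hjw h1 h2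
  rw [crossCount, List.countP_eq_zero] at h
  refine h (j - 1) (by simp; omega) ?_
  rw [Nat.sub_add_cancel hj, Bool.and_eq_true, List.isPrefixOf_iff_prefix,
    List.isPrefixOf_iff_prefix, List.reverse_prefix]
  exact ⟨h1, h2⟩

theorem isPrefixOf_take {w l : Word} {k : ℕ} (h : w.length ≤ k) :
    w.isPrefixOf (l.take k) = w.isPrefixOf l := by
  rw [Bool.eq_iff_iff, List.isPrefixOf_iff_prefix, List.isPrefixOf_iff_prefix,
    List.prefix_take_iff]
  exact and_iff_left h

theorem crossCount_take {w r t : Word} {k l : ℕ} (hk : w.length ≤ k + 1) (hl : w.length ≤ l + 1) :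
    crossCount w (r.take k) (t.take l) = crossCount w r t := by
  rw [crossCount, crossCount]
  refine List.countP_congr fun j hj => ?_
  have hj' := List.mem_range.1 hj
  rw [isPrefixOf_take (by simp; omega), isPrefixOf_take (by simp; omega)]

theorem lossCount_take {w r t : Word} {b : Bool} {k : ℕ} (hk : w.length ≤ k + 1) :
    lossCount w b (r.take k) (t.take k) = lossCount w b r t := by
  rw [lossCount, lossCount, ← List.take_succ_cons, crossCount_take hk (by omega),
    isPrefixOf_take hk]

theorem innerDel_of_count {w A B : Word} {b : Bool} (hw : w ≠ [])
    (h : lossCount w b A.reverse B = 0) (h' : crossCount w A.reverse B = 0) :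
    InnerDel 1 w (A ++ B) (A ++ b :: B) := by
  have h1 := Nat.eq_zero_of_add_eq_zero h
  refine innerDel_of_noCross hw (noCross_of_crossCount h1.1) ?_ (noCross_of_crossCount h')
  have := h1.2
  simpa using this

theorem numOcc_delete {w A B : Word} {b : Bool} (hw : w ≠ []) :
    numOcc w (A ++ b :: B) + crossCount w A.reverse B =
      numOcc w (A ++ B) + lossCount w b A.reverse B := by
  rw [numOcc_append hw, numOcc_append hw, numOcc_cons, lossCount]
  omega

/-! ### Local effect of a deletion, by a finite check. -/

/-- All words of length at most `k`. -/
def wordsUpTo : ℕ → List Word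
  | 0 => [[]]
  | k + 1 => [] :: (wordsUpTo k).flatMap fun l => [false :: l, true :: l]

theorem mem_wordsUpTo {k : ℕ} {l : Word} (h : l.length ≤ k) : l ∈ wordsUpTo k := by
  induction k generalizing l with
  | zero => simp [wordsUpTo, List.eq_nil_of_length_eq_zero (Nat.le_zero.1 h)]
  | succ k ih =>
    cases l with
    | nil => simp [wordsUpTo]
    | cons b l =>
      have := ih (l := l) (by simpa using h)
      simp only [wordsUpTo, List.mem_cons, List.mem_flatMap]
      exact Or.inr ⟨l, this, by cases b <;> simp⟩

/-- The possible effects of deleting the symbol `0` between `r.reverse` and `t` on the occurrences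
of the four marker words. -/
abbrev ZeroEffect (r t : Word) : Prop :=
  lossCount w1111 false r t = 0 ∧ crossCount w1111 r t ≤ 3 ∧
  crossCount w0000 r t ≤ lossCount w0000 false r t ∧
  lossCount w0000 false r t ≤ crossCount w0000 r t + 1 ∧
  (lossCount w0000 false r t = crossCount w0000 r t → crossCount w0000 r t = 0) ∧
  (lossCount w0000 false r t ≠ crossCount w0000 r t →
    crossCount w1111 r t = 0 ∧
    lossCount w110011 false r t = 0 ∧ crossCount w110011 r t = 0 ∧
    lossCount w11011 false r t = 0 ∧ crossCount w11011 r t = 0) ∧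
  (crossCount w1111 r t ≠ 0 →
    lossCount w11011 false r t ≤ 1 ∧ crossCount w11011 r t ≤ 1 ∧
    (lossCount w11011 false r t = 0 ∧ crossCount w11011 r t = 0 ∨
     lossCount w11011 false r t ≠ crossCount w11011 r t ∧
      lossCount w110011 false r t = 0 ∧ crossCount w110011 r t = 0))

/-- The possible effects of deleting the symbol `1` between `r.reverse` and `t` on the occurrences
of the four marker words. -/
abbrev OneEffect (r t : Word) : Prop :=
  lossCount w0000 true r t = 0 ∧ crossCount w0000 r t ≤ 3 ∧
  crossCount w1111 r t ≤ lossCount w1111 true r t ∧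
  lossCount w1111 true r t ≤ crossCount w1111 r t + 1 ∧
  (lossCount w1111 true r t = crossCount w1111 r t → crossCount w1111 r t = 0) ∧
  (lossCount w1111 true r t ≠ crossCount w1111 r t → crossCount w0000 r t = 0) ∧
  (crossCount w0000 r t ≠ 0 →
    lossCount w110011 true r t = 0 ∧ crossCount w110011 r t = 0 ∧
    lossCount w11011 true r t = 0 ∧ crossCount w11011 r t = 0)

/-- Markers have at most six symbols, so an occurrence meeting the cut reaches at most five symbols
to either side. Shorter windows are needed near the ends of the word; the left context is reversed
so that its nearest symbols come first. -/
theorem zeroEffect_window :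
    ∀ r ∈ wordsUpTo 5, ∀ t ∈ wordsUpTo 5, ZeroEffect r t := by decide +kernel

theorem oneEffect_window :
    ∀ r ∈ wordsUpTo 5, ∀ t ∈ wordsUpTo 5, OneEffect r t := by decide +kernel

theorem lossCount_w1111_ne_imp :
    ∀ r ∈ wordsUpTo 3, ∀ t ∈ wordsUpTo 3, lossCount w1111 true r t ≠ crossCount w1111 r t →
      [true, true, true] <+: r ∨ [true, true] <+: r ∧ [true] <+: t ∨
      [true] <+: r ∧ [true, true] <+: t ∨ [true, true, true] <+: t := by
  decide +kernel

theorem zeroEffect (r t : Word) : ZeroEffect r t := by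
  have h := zeroEffect_window (r.take 5) (mem_wordsUpTo (by simp)) (t.take 5)
    (mem_wordsUpTo (by simp))
  simpa only [ZeroEffect, lossCount_take (k := 5) (show w1111.length ≤ 6 by decide),
    lossCount_take (k := 5) (show w0000.length ≤ 6 by decide),
    lossCount_take (k := 5) (show w110011.length ≤ 6 by decide),
    lossCount_take (k := 5) (show w11011.length ≤ 6 by decide),
    crossCount_take (k := 5) (l := 5) (show w1111.length ≤ 6 by decide) (by decide),
    crossCount_take (k := 5) (l := 5) (show w0000.length ≤ 6 by decide) (by decide),
    crossCount_take (k := 5) (l := 5) (show w110011.length ≤ 6 by decide) (by decide),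
    crossCount_take (k := 5) (l := 5) (show w11011.length ≤ 6 by decide) (by decide)] using h

theorem oneEffect (r t : Word) : OneEffect r t := by
  have h := oneEffect_window (r.take 5) (mem_wordsUpTo (by simp)) (t.take 5)
    (mem_wordsUpTo (by simp))
  simpa only [OneEffect, lossCount_take (k := 5) (show w1111.length ≤ 6 by decide),
    lossCount_take (k := 5) (show w0000.length ≤ 6 by decide),
    lossCount_take (k := 5) (show w110011.length ≤ 6 by decide),
    lossCount_take (k := 5) (show w11011.length ≤ 6 by decide),
    crossCount_take (k := 5) (l := 5) (show w1111.length ≤ 6 by decide) (by decide),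
    crossCount_take (k := 5) (l := 5) (show w0000.length ≤ 6 by decide) (by decide),
    crossCount_take (k := 5) (l := 5) (show w110011.length ≤ 6 by decide) (by decide),
    crossCount_take (k := 5) (l := 5) (show w11011.length ≤ 6 by decide) (by decide)] using h

/-! ### Deletions in a run of at least four ones. -/

theorem exists_run_of_numOcc_ne {A B : Word}
    (h : lossCount w1111 true A.reverse B ≠ crossCount w1111 A.reverse B) :
    ∃ C D : Word, A ++ true :: B = C ++ [true, true] ++ true :: true :: D ∧
      A ++ B = C ++ [true, true] ++ true :: D := by
  have h' := lossCount_w1111_ne_imp (A.reverse.take 3) (mem_wordsUpTo (by simp)) (B.take 3)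
    (mem_wordsUpTo (by simp))
  rw [lossCount_take (by decide), crossCount_take (by decide) (by decide)] at h'
  simp only [List.prefix_take_iff] at h'
  have e : ∀ u : Word, u <+: A.reverse ↔ u.reverse <:+ A := fun u => by
    rw [← List.reverse_prefix, List.reverse_reverse]
  simp only [e] at h'
  -- The result is the same whichever 1 of the run is deleted, so all four positions of the cut
  -- within 1111 lead to one normal form.
  rcases h' h with ⟨⟨C, rfl⟩, -⟩ | ⟨⟨⟨C, rfl⟩, -⟩, ⟨D, rfl⟩, -⟩ |
    ⟨⟨⟨C, rfl⟩, -⟩, ⟨D, rfl⟩, -⟩ | ⟨⟨D, rfl⟩, -⟩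
  · exact ⟨C, B, by simp, by simp⟩
  · exact ⟨C, D, by simp, by simp⟩
  · exact ⟨C, D, by simp, by simp⟩
  · exact ⟨A, D, by simp, by simp⟩

/-- Neither long marker contains 111. With 11 before the cut and 1 after it, an occurrence meeting
the cut must therefore begin with the last two ones shown, and its remainder must begin `t`. -/
theorem run_window_right : ∀ r ∈ wordsUpTo 3, ∀ t ∈ wordsUpTo 4,
    (¬ [false, false, true, true] <+: t →
      lossCount w110011 true (true :: true :: r) (true :: t) = 0 ∧
      crossCount w110011 (true :: true :: r) (true :: t) = 0) ∧
    (¬ [false, true, true] <+: t →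
      lossCount w11011 true (true :: true :: r) (true :: t) = 0 ∧
      crossCount w11011 (true :: true :: r) (true :: t) = 0) := by
  decide +kernel

theorem run_window_left : ∀ r ∈ wordsUpTo 4, ∀ t ∈ wordsUpTo 3,
    (¬ [false, false, true, true] <+: r →
      lossCount w110011 true (true :: r) (true :: true :: t) = 0 ∧
      crossCount w110011 (true :: r) (true :: true :: t) = 0) ∧
    (¬ [false, true, true] <+: r →
      lossCount w11011 true (true :: r) (true :: true :: t) = 0 ∧
      crossCount w11011 (true :: r) (true :: true :: t) = 0) := by
  decide +kernel

theorem prefix_take_four {u t : Word} (hu : u.length ≤ 4) : u <+: t.take 4 ↔ u <+: t := by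
  rw [List.prefix_take_iff]
  exact and_iff_left hu

theorem innerDel_run_right (C D : Word) :
    (¬ [false, false, true, true] <+: D →
      InnerDel 1 w110011 (C ++ [true, true] ++ true :: D)
        (C ++ [true, true] ++ true :: true :: D)) ∧
    (¬ [false, true, true] <+: D →
      InnerDel 1 w11011 (C ++ [true, true] ++ true :: D)
        (C ++ [true, true] ++ true :: true :: D)) := by
  have h := run_window_right (C.reverse.take 3) (mem_wordsUpTo (by simp)) (D.take 4)
    (mem_wordsUpTo (by simp))
  simp only [← List.take_succ_cons,
    prefix_take_four (show [false, false, true, true].length ≤ 4 by decide),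
    prefix_take_four (show [false, true, true].length ≤ 4 by decide)] at h
  simp only [lossCount_take (k := 5) (show w110011.length ≤ 6 by decide),
    lossCount_take (k := 5) (show w11011.length ≤ 6 by decide),
    crossCount_take (k := 5) (l := 5) (show w110011.length ≤ 6 by decide) (by decide),
    crossCount_take (k := 5) (l := 5) (show w11011.length ≤ 6 by decide) (by decide)] at h
  exact ⟨fun hD => innerDel_of_count (by decide) (by simpa using (h.1 hD).1)
      (by simpa using (h.1 hD).2),
    fun hD => innerDel_of_count (by decide) (by simpa using (h.2 hD).1)
      (by simpa using (h.2 hD).2)⟩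

theorem innerDel_run_left (C D : Word) :
    (¬ [false, false, true, true] <+: C.reverse →
      InnerDel 1 w110011 (C ++ [true, true] ++ true :: D)
        (C ++ [true, true] ++ true :: true :: D)) ∧
    (¬ [false, true, true] <+: C.reverse →
      InnerDel 1 w11011 (C ++ [true, true] ++ true :: D)
        (C ++ [true, true] ++ true :: true :: D)) := by
  have h := run_window_left (C.reverse.take 4) (mem_wordsUpTo (by simp)) (D.take 3)
    (mem_wordsUpTo (by simp))
  simp only [← List.take_succ_cons,
    prefix_take_four (show [false, false, true, true].length ≤ 4 by decide),
    prefix_take_four (show [false, true, true].length ≤ 4 by decide)] at h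
  simp only [lossCount_take (k := 5) (show w110011.length ≤ 6 by decide),
    lossCount_take (k := 5) (show w11011.length ≤ 6 by decide),
    crossCount_take (k := 5) (l := 5) (show w110011.length ≤ 6 by decide) (by decide),
    crossCount_take (k := 5) (l := 5) (show w11011.length ≤ 6 by decide) (by decide)] at h
  have e1 : C ++ [true, true] ++ true :: D = (C ++ [true]) ++ true :: true :: D := by simp
  have e2 : C ++ [true, true] ++ true :: true :: D =
    (C ++ [true]) ++ true :: true :: true :: D := by simp
  rw [e1, e2]
  exact ⟨fun hD => innerDel_of_count (by decide) (by simpa using (h.1 hD).1)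
      (by simpa using (h.1 hD).2),
    fun hD => innerDel_of_count (by decide) (by simpa using (h.2 hD).1)
      (by simpa using (h.2 hD).2)⟩

theorem segments_eq_run_w110011 (C D : Word) :
    segments w110011 (C ++ [true, true, false, false, true, true] ++
        [true, false, false, true, true] ++ D) =
      segments w110011 (C ++ [true, true, false, false, true, true] ++
        [true, true, false, false, true, true] ++ D) := by
  have := segments_eq_of_touching (w := w110011) (C := C) (b := true)
    (B := [true, false, false, true, true] ++ D) rfl (by decide) ?_ ?_ ?_ ?_ ?_
  · simpa [w110011] using this
  · intro j h0 h1
    have : j < 6 := h1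
    interval_cases j <;> simp [w110011, ← List.reverse_prefix]
  · simp [w110011]
  · intro j h0 h1
    have : j < 6 := h1
    interval_cases j <;> simp [w110011, ← List.reverse_prefix]
  · simp [w110011, ← List.reverse_prefix]
  · simp [w110011]

theorem segments_eq_run_w11011 (C D : Word) :
    segments w11011 (C ++ [true, true, false, true, true] ++ [true, false, true, true] ++ D) =
      segments w11011 (C ++ [true, true, false, true, true] ++
        [true, true, false, true, true] ++ D) := by
  have := segments_eq_of_touching (w := w11011) (C := C) (b := true)
    (B := [true, false, true, true] ++ D) rfl (by decide) ?_ ?_ ?_ ?_ ?_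
  · simpa [w11011] using this
  · intro j h0 h1
    have : j < 5 := h1
    interval_cases j <;> simp [w11011, ← List.reverse_prefix]
  · simp [w11011]
  · intro j h0 h1
    have : j < 5 := h1
    interval_cases j <;> simp [w11011, ← List.reverse_prefix]
  · simp [w11011, ← List.reverse_prefix]
  · simp [w11011]

/-- `t` deletions that lie inside the substrings delimited by `110011` and inside those delimited by
`11011`, except that for one of these two words only `s` of them may show in the substrings. -/
def RunDel (s t : ℕ) (y x : Word) : Prop :=
  (InnerDel t w110011 y x ∧ InnerDel t w11011 y x) ∨
  (ListDel s (segments w110011 y) (segments w110011 x) ∧ InnerDel t w11011 y x) ∨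
  (InnerDel t w110011 y x ∧ ListDel s (segments w11011 y) (segments w11011 x))

/-- The cut can be moved towards either end of the run, so a marker suffers only if copies of it
adjoin on both sides, that is, if two touching copies form the run 1111. Then its segments are
unchanged. Both markers cannot suffer, since `D` cannot begin with both 0011 and 011. -/
theorem runDel_run (C D : Word) :
    RunDel 0 1 (C ++ [true, true] ++ true :: D) (C ++ [true, true] ++ true :: true :: D) := by
  have hr := innerDel_run_right C D
  have hl := innerDel_run_left C D
  by_cases d1 : [false, false, true, true] <+: D
  · have d2 : ¬ [false, true, true] <+: D := by
      obtain ⟨E, rfl⟩ := d1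
      simp
    by_cases c1 : [false, false, true, true] <+: C.reverse
    · refine Or.inr (Or.inl ⟨?_, hr.2 d2⟩)
      obtain ⟨E, rfl⟩ := d1
      rw [show [false, false, true, true] = [true, true, false, false].reverse from rfl,
        List.reverse_prefix] at c1
      obtain ⟨F, rfl⟩ := c1
      have := segments_eq_run_w110011 F E
      simp only [List.append_assoc, List.cons_append, List.nil_append] at this ⊢
      rw [this]
      exact ListDel.refl _
    · exact Or.inl ⟨hl.1 c1, hr.2 d2⟩
  · by_cases d2 : [false, true, true] <+: D
    · by_cases c2 : [false, true, true] <+: C.reverse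
      · refine Or.inr (Or.inr ⟨hr.1 d1, ?_⟩)
        obtain ⟨E, rfl⟩ := d2
        rw [show [false, true, true] = [true, true, false].reverse from rfl,
          List.reverse_prefix] at c2
        obtain ⟨F, rfl⟩ := c2
        have := segments_eq_run_w11011 F E
        simp only [List.append_assoc, List.cons_append, List.nil_append] at this ⊢
        rw [this]
        exact ListDel.refl _
      · exact Or.inl ⟨hr.1 d1, hl.2 c2⟩
    · exact Or.inl ⟨hr.1 d1, hr.2 d2⟩

/-! ### The effect of one deletion on the four markers. -/

theorem delete_zero_cases (A B : Word) :
    (numOcc w0000 (A ++ false :: B) = numOcc w0000 (A ++ B) + 1 ∧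
      InnerDel 1 w1111 (A ++ B) (A ++ false :: B) ∧
      InnerDel 1 w110011 (A ++ B) (A ++ false :: B) ∧
      InnerDel 1 w11011 (A ++ B) (A ++ false :: B)) ∨
    (InnerDel 1 w0000 (A ++ B) (A ++ false :: B) ∧
      numOcc w1111 (A ++ false :: B) < numOcc w1111 (A ++ B) ∧
      numOcc w1111 (A ++ B) ≤ numOcc w1111 (A ++ false :: B) + 3 ∧
      (InnerDel 1 w11011 (A ++ B) (A ++ false :: B) ∨
        numOcc w11011 (A ++ false :: B) ≠ numOcc w11011 (A ++ B) ∧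
        numOcc w11011 (A ++ false :: B) ≤ numOcc w11011 (A ++ B) + 1 ∧
        numOcc w11011 (A ++ B) ≤ numOcc w11011 (A ++ false :: B) + 1 ∧
        InnerDel 1 w110011 (A ++ B) (A ++ false :: B))) ∨
    (InnerDel 1 w0000 (A ++ B) (A ++ false :: B) ∧
      InnerDel 1 w1111 (A ++ B) (A ++ false :: B)) := by
  obtain ⟨h1, h2, h3, h4, h5, h6, h7⟩ := zeroEffect A.reverse B
  have n0 := numOcc_delete (w := w0000) (A := A) (B := B) (b := false) (by decide)
  have n1 := numOcc_delete (w := w1111) (A := A) (B := B) (b := false) (by decide)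
  have n2 := numOcc_delete (w := w11011) (A := A) (B := B) (b := false) (by decide)
  by_cases e0 : lossCount w0000 false A.reverse B = crossCount w0000 A.reverse B
  · have i0 : InnerDel 1 w0000 (A ++ B) (A ++ false :: B) :=
      innerDel_of_count (by decide) (by rw [e0, h5 e0]) (h5 e0)
    by_cases e1 : crossCount w1111 A.reverse B = 0
    · exact Or.inr (Or.inr ⟨i0, innerDel_of_count (by decide) h1 e1⟩)
    -- A new 1111 means that the deleted 0 separated ones, at least four in all. Losing 11011 needs
    -- two ones on each side, creating it needs a single one on some side, so these effects never
    -- cancel.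
    · refine Or.inr (Or.inl ⟨i0, by omega, by omega, ?_⟩)
      obtain ⟨k1, k2, ⟨k3, k4⟩ | ⟨k3, k4, k5⟩⟩ := h7 e1
      · exact Or.inl (innerDel_of_count (by decide) k3 k4)
      · exact Or.inr ⟨by omega, by omega, by omega, innerDel_of_count (by decide) k4 k5⟩
  · obtain ⟨k1, k2, k3, k4, k5⟩ := h6 e0
    exact Or.inl ⟨by omega, innerDel_of_count (by decide) h1 k1,
      innerDel_of_count (by decide) k2 k3, innerDel_of_count (by decide) k4 k5⟩

/-- A 1 whose deletion creates 0000 stands between zeros and so lies in no long marker; the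
resulting run of at least four zeros is too long to meet one. A 1 whose deletion lowers N_1111 lies
in a run covered by `runDel_run`. -/
theorem delete_one_cases (A B : Word) :
    (numOcc w1111 (A ++ true :: B) = numOcc w1111 (A ++ B) + 1 ∧
      InnerDel 1 w0000 (A ++ B) (A ++ true :: B) ∧
      RunDel 0 1 (A ++ B) (A ++ true :: B)) ∨
    (InnerDel 1 w1111 (A ++ B) (A ++ true :: B) ∧
      numOcc w0000 (A ++ true :: B) < numOcc w0000 (A ++ B) ∧
      numOcc w0000 (A ++ B) ≤ numOcc w0000 (A ++ true :: B) + 3 ∧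
      InnerDel 1 w110011 (A ++ B) (A ++ true :: B) ∧
      InnerDel 1 w11011 (A ++ B) (A ++ true :: B)) ∨
    (InnerDel 1 w0000 (A ++ B) (A ++ true :: B) ∧
      InnerDel 1 w1111 (A ++ B) (A ++ true :: B)) := by
  obtain ⟨h1, h2, h3, h4, h5, h6, h7⟩ := oneEffect A.reverse B
  have n0 := numOcc_delete (w := w0000) (A := A) (B := B) (b := true) (by decide)
  have n1 := numOcc_delete (w := w1111) (A := A) (B := B) (b := true) (by decide)
  by_cases e1 : lossCount w1111 true A.reverse B = crossCount w1111 A.reverse B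
  · have i1 : InnerDel 1 w1111 (A ++ B) (A ++ true :: B) :=
      innerDel_of_count (by decide) (by rw [e1, h5 e1]) (h5 e1)
    by_cases e0 : crossCount w0000 A.reverse B = 0
    · exact Or.inr (Or.inr ⟨innerDel_of_count (by decide) h1 e0, i1⟩)
    · obtain ⟨k1, k2, k3, k4⟩ := h7 e0
      exact Or.inr (Or.inl ⟨i1, by omega, by omega, innerDel_of_count (by decide) k1 k2,
        innerDel_of_count (by decide) k3 k4⟩)
  · refine Or.inl ⟨by omega, innerDel_of_count (by decide) h1 (h6 e1), ?_⟩
    obtain ⟨C, D, e, e'⟩ := exists_run_of_numOcc_ne e1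
    rw [e, e']
    exact runDel_run C D

/-! ### The combined effect of two deletions. -/

theorem exists_delete_of_sublist {x y : Word} (h : y.Sublist x) (hl : y.length < x.length) :
    ∃ (A B : Word) (b : Bool), x = A ++ b :: B ∧ y.Sublist (A ++ B) := by
  induction h with
  | slnil => simp at hl
  | @cons l₁ l₂ a h _ => exact ⟨[], l₂, a, rfl, h⟩
  | @cons_cons l₁ l₂ a h ih =>
    obtain ⟨A, B, b, rfl, hs⟩ := ih (by simpa using hl)
    exact ⟨a :: A, B, b, rfl, hs.cons_cons a⟩

/-- `y` arises from `x` by deleting one symbol `b`. -/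
def DeletesTo (b : Bool) (x y : Word) : Prop :=
  ∃ A B : Word, x = A ++ b :: B ∧ y = A ++ B

theorem exists_deletesTo {x y : Word} (h : y ∈ deletionBall 2 x) :
    ∃ (b b' : Bool) (z : Word), DeletesTo b x z ∧ DeletesTo b' z y := by
  obtain ⟨h1, h2⟩ := h
  obtain ⟨A, B, b, rfl, hs⟩ := exists_delete_of_sublist h1 (by omega)
  have hl : y.length + 1 = (A ++ B).length := by simp at h2 ⊢; omega
  obtain ⟨C, D, b', e, hs'⟩ := exists_delete_of_sublist hs (by omega)
  rw [e] at hl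
  exact ⟨b, b', A ++ B, ⟨A, B, rfl, rfl⟩, C, D, e, hs'.eq_of_length (by simp at hl ⊢; omega)⟩

theorem DeletesTo.count {b : Bool} {x y : Word} (h : DeletesTo b x y) (d : Bool) :
    x.count d = y.count d + if b = d then 1 else 0 := by
  obtain ⟨A, B, rfl, rfl⟩ := h
  simp [List.count_append, List.count_cons, Nat.add_assoc]

/-- What two deletions can do to the occurrences of the four marker words. -/
def Effect (y x : Word) : Prop :=
  (InnerDel 2 w0000 y x ∧ InnerDel 2 w1111 y x) ∨
  (InnerDel 2 w1111 y x ∧ numOcc w0000 y ≠ numOcc w0000 x) ∨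
  (InnerDel 2 w1111 y x ∧ InnerDel 2 w11011 y x) ∨
  (InnerDel 2 w0000 y x ∧ numOcc w1111 y ≠ numOcc w1111 x) ∨
  (InnerDel 2 w0000 y x ∧
    (InnerDel 2 w11011 y x ∨ ListDel 1 (segments w11011 y) (segments w11011 x) ∨
      (numOcc w11011 x ≠ numOcc w11011 y ∧ numOcc w11011 x ≤ numOcc w11011 y + 1 ∧
        numOcc w11011 y ≤ numOcc w11011 x + 1))) ∨
  (numOcc w1111 y < numOcc w1111 x ∧ numOcc w0000 y ≠ numOcc w0000 x ∧ RunDel 1 2 y x) ∨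
  (numOcc w1111 x < numOcc w1111 y ∧ numOcc w0000 y ≠ numOcc w0000 x ∧
    (InnerDel 2 w11011 y x ∨
      numOcc w11011 x ≠ numOcc w11011 y ∧ numOcc w11011 x ≤ numOcc w11011 y + 1 ∧
      numOcc w11011 y ≤ numOcc w11011 x + 1 ∧ InnerDel 2 w110011 y x))

/-- The change in the number of occurrences of `w` lies between `-k` and `6 - k`. -/
def CountChange (k : ℕ) (w y x : Word) : Prop :=
  numOcc w x ≤ numOcc w y + k ∧ numOcc w y + k ≤ numOcc w x + 6

theorem RunDel.trans_inner {x y z : Word} (h : RunDel 0 1 y z) (h1 : InnerDel 1 w110011 z x)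
    (h2 : InnerDel 1 w11011 z x) : RunDel 1 2 y x := by
  rcases h with ⟨a, b⟩ | ⟨a, b⟩ | ⟨a, b⟩
  · exact Or.inl ⟨a.trans h1, b.trans h2⟩
  · exact Or.inr (Or.inl ⟨a.trans h1.1, b.trans h2⟩)
  · exact Or.inr (Or.inr ⟨a.trans h1, b.trans h2.1⟩)

theorem RunDel.inner_trans {x y z : Word} (h : RunDel 0 1 z x) (h1 : InnerDel 1 w110011 y z)
    (h2 : InnerDel 1 w11011 y z) : RunDel 1 2 y x := by
  rcases h with ⟨a, b⟩ | ⟨a, b⟩ | ⟨a, b⟩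
  · exact Or.inl ⟨h1.trans a, h2.trans b⟩
  · exact Or.inr (Or.inl ⟨h1.1.trans a, h2.trans b⟩)
  · exact Or.inr (Or.inr ⟨h1.trans a, h2.1.trans b⟩)

theorem RunDel.innerDel_or_listDel {s t : ℕ} {y x : Word} (h : RunDel s t y x) :
    InnerDel t w11011 y x ∨ ListDel s (segments w11011 y) (segments w11011 x) := by
  rcases h with ⟨-, h⟩ | ⟨-, h⟩ | ⟨-, h⟩
  exacts [Or.inl h, Or.inl h, Or.inr h]

theorem RunDel.numOcc_w11011_eq {s t : ℕ} {y x : Word} (h : RunDel s t y x) :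
    numOcc w11011 y = numOcc w11011 x :=
  h.innerDel_or_listDel.elim InnerDel.numOcc_eq ListDel.numOcc_eq

theorem effect_zero_zero {x y z : Word} (h : DeletesTo false x z) (h' : DeletesTo false z y) :
    CountChange 2 w0000 y x ∧ CountChange 0 w1111 y x ∧ Effect y x := by
  obtain ⟨A, B, rfl, rfl⟩ := h
  obtain ⟨C, D, e, rfl⟩ := h'
  have hx := delete_zero_cases A B
  have hy := delete_zero_cases C D
  rw [← e] at hy
  generalize A ++ false :: B = x at *
  generalize A ++ B = z at *
  generalize C ++ D = y at *
  simp only [CountChange]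
  rcases hx with ⟨a, i1, i2, i3⟩ | ⟨i0, a, a', a''⟩ | ⟨i0, i1⟩ <;>
  rcases hy with ⟨b, j1, j2, j3⟩ | ⟨j0, b, b', b''⟩ | ⟨j0, j1⟩
  · have := i1.numOcc_eq; have := j1.numOcc_eq
    exact ⟨by omega, by omega, Or.inr (Or.inl ⟨j1.trans i1, by omega⟩)⟩
  · have := i1.numOcc_eq; have := j0.numOcc_eq; have := i3.numOcc_eq
    refine ⟨by omega, by omega, .inr (.inr (.inr (.inr (.inr (.inr ⟨by omega, by omega, ?_⟩)))))⟩
    rcases b'' with b'' | ⟨b1, b2, b3, b4⟩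
    · exact .inl (b''.trans i3)
    · exact .inr ⟨by omega, by omega, by omega, b4.trans i2⟩
  · have := i1.numOcc_eq; have := j1.numOcc_eq; have := j0.numOcc_eq
    exact ⟨by omega, by omega, Or.inr (Or.inl ⟨j1.trans i1, by omega⟩)⟩
  · have := i0.numOcc_eq; have := j1.numOcc_eq; have := j3.numOcc_eq
    refine ⟨by omega, by omega, .inr (.inr (.inr (.inr (.inr (.inr ⟨by omega, by omega, ?_⟩)))))⟩
    rcases a'' with a'' | ⟨b1, b2, b3, b4⟩
    · exact .inl (j3.trans a'')
    · exact .inr ⟨by omega, by omega, by omega, j2.trans b4⟩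
  · have := i0.numOcc_eq; have := j0.numOcc_eq
    exact ⟨by omega, by omega, .inr (.inr (.inr (.inl ⟨j0.trans i0, by omega⟩)))⟩
  · have := i0.numOcc_eq; have := j0.numOcc_eq; have := j1.numOcc_eq
    exact ⟨by omega, by omega, .inr (.inr (.inr (.inl ⟨j0.trans i0, by omega⟩)))⟩
  · have := i1.numOcc_eq; have := j1.numOcc_eq; have := i0.numOcc_eq
    exact ⟨by omega, by omega, Or.inr (Or.inl ⟨j1.trans i1, by omega⟩)⟩
  · have := i0.numOcc_eq; have := j0.numOcc_eq; have := i1.numOcc_eq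
    exact ⟨by omega, by omega, .inr (.inr (.inr (.inl ⟨j0.trans i0, by omega⟩)))⟩
  · have := i0.numOcc_eq; have := j0.numOcc_eq; have := i1.numOcc_eq; have := j1.numOcc_eq
    exact ⟨by omega, by omega, .inl ⟨j0.trans i0, j1.trans i1⟩⟩

theorem effect_one_one {x y z : Word} (h : DeletesTo true x z) (h' : DeletesTo true z y) :
    CountChange 0 w0000 y x ∧ CountChange 2 w1111 y x ∧ Effect y x := by
  obtain ⟨A, B, rfl, rfl⟩ := h
  obtain ⟨C, D, e, rfl⟩ := h'
  have hx := delete_one_cases A B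
  have hy := delete_one_cases C D
  rw [← e] at hy
  generalize A ++ true :: B = x at *
  generalize A ++ B = z at *
  generalize C ++ D = y at *
  simp only [CountChange]
  rcases hx with ⟨a, i0, r⟩ | ⟨i1, a, a', i2, i3⟩ | ⟨i0, i1⟩ <;>
  rcases hy with ⟨b, j0, r'⟩ | ⟨j1, b, b', j2, j3⟩ | ⟨j0, j1⟩
  · have := i0.numOcc_eq; have := j0.numOcc_eq
    exact ⟨by omega, by omega, .inr (.inr (.inr (.inl ⟨j0.trans i0, by omega⟩)))⟩
  · have := i0.numOcc_eq; have := j1.numOcc_eq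
    exact ⟨by omega, by omega, .inr (.inr (.inr (.inr (.inr (.inl
      ⟨by omega, by omega, r.inner_trans j2 j3⟩)))))⟩
  · have := i0.numOcc_eq; have := j0.numOcc_eq; have := j1.numOcc_eq
    exact ⟨by omega, by omega, .inr (.inr (.inr (.inl ⟨j0.trans i0, by omega⟩)))⟩
  · have := i1.numOcc_eq; have := j0.numOcc_eq
    exact ⟨by omega, by omega, .inr (.inr (.inr (.inr (.inr (.inl
      ⟨by omega, by omega, r'.trans_inner i2 i3⟩)))))⟩
  · have := i1.numOcc_eq; have := j1.numOcc_eq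
    exact ⟨by omega, by omega, .inr (.inl ⟨j1.trans i1, by omega⟩)⟩
  · have := i1.numOcc_eq; have := j1.numOcc_eq; have := j0.numOcc_eq
    exact ⟨by omega, by omega, .inr (.inl ⟨j1.trans i1, by omega⟩)⟩
  · have := i0.numOcc_eq; have := j0.numOcc_eq; have := i1.numOcc_eq
    exact ⟨by omega, by omega, .inr (.inr (.inr (.inl ⟨j0.trans i0, by omega⟩)))⟩
  · have := i1.numOcc_eq; have := j1.numOcc_eq; have := i0.numOcc_eq
    exact ⟨by omega, by omega, .inr (.inl ⟨j1.trans i1, by omega⟩)⟩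
  · have := i0.numOcc_eq; have := j0.numOcc_eq; have := i1.numOcc_eq; have := j1.numOcc_eq
    exact ⟨by omega, by omega, .inl ⟨j0.trans i0, j1.trans i1⟩⟩

/-- Only deletions of different symbols can cancel. If N_0000 falls and rises, 1111 and 11011 are
preserved; if N_1111 rises and falls, 0000 is preserved and the behaviour of 11011 is recorded for
the comparison with the former case. -/
theorem effect_zero_one {x y z : Word} (h : DeletesTo false x z) (h' : DeletesTo true z y) :
    CountChange 1 w0000 y x ∧ CountChange 1 w1111 y x ∧ Effect y x := by
  obtain ⟨A, B, rfl, rfl⟩ := h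
  obtain ⟨C, D, e, rfl⟩ := h'
  have hx := delete_zero_cases A B
  have hy := delete_one_cases C D
  rw [← e] at hy
  generalize A ++ false :: B = x at *
  generalize A ++ B = z at *
  generalize C ++ D = y at *
  simp only [CountChange]
  rcases hx with ⟨a, i1, i2, i3⟩ | ⟨i0, a, a', a''⟩ | ⟨i0, i1⟩ <;>
  rcases hy with ⟨b, j0, r'⟩ | ⟨j1, b, b', j2, j3⟩ | ⟨j0, j1⟩
  · have := i1.numOcc_eq; have := j0.numOcc_eq
    exact ⟨by omega, by omega, .inr (.inr (.inr (.inr (.inr (.inl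
      ⟨by omega, by omega, r'.trans_inner i2 i3⟩)))))⟩
  · have := i1.numOcc_eq; have := j1.numOcc_eq
    exact ⟨by omega, by omega, .inr (.inr (.inl ⟨j1.trans i1, j3.trans i3⟩))⟩
  · have := i1.numOcc_eq; have := j1.numOcc_eq; have := j0.numOcc_eq
    exact ⟨by omega, by omega, .inr (.inl ⟨j1.trans i1, by omega⟩)⟩
  · have := i0.numOcc_eq; have := j0.numOcc_eq; have := r'.numOcc_w11011_eq
    refine ⟨by omega, by omega, .inr (.inr (.inr (.inr (.inl ⟨j0.trans i0, ?_⟩))))⟩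
    rcases a'' with a'' | ⟨b1, b2, b3, b4⟩
    · exact r'.innerDel_or_listDel.imp (fun k => k.trans a'') fun k => .inl (k.trans a''.1)
    · exact .inr (.inr ⟨by omega, by omega, by omega⟩)
  · have := i0.numOcc_eq; have := j1.numOcc_eq; have := j3.numOcc_eq
    refine ⟨by omega, by omega, .inr (.inr (.inr (.inr (.inr (.inr ⟨by omega, by omega, ?_⟩)))))⟩
    rcases a'' with a'' | ⟨b1, b2, b3, b4⟩
    · exact .inl (j3.trans a'')
    · exact .inr ⟨by omega, by omega, by omega, j2.trans b4⟩
  · have := i0.numOcc_eq; have := j0.numOcc_eq; have := j1.numOcc_eq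
    exact ⟨by omega, by omega, .inr (.inr (.inr (.inl ⟨j0.trans i0, by omega⟩)))⟩
  · have := i0.numOcc_eq; have := j0.numOcc_eq; have := i1.numOcc_eq
    exact ⟨by omega, by omega, .inr (.inr (.inr (.inl ⟨j0.trans i0, by omega⟩)))⟩
  · have := i1.numOcc_eq; have := j1.numOcc_eq; have := i0.numOcc_eq
    exact ⟨by omega, by omega, .inr (.inl ⟨j1.trans i1, by omega⟩)⟩
  · have := i0.numOcc_eq; have := j0.numOcc_eq; have := i1.numOcc_eq; have := j1.numOcc_eq
    exact ⟨by omega, by omega, .inl ⟨j0.trans i0, j1.trans i1⟩⟩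

theorem effect_one_zero {x y z : Word} (h : DeletesTo true x z) (h' : DeletesTo false z y) :
    CountChange 1 w0000 y x ∧ CountChange 1 w1111 y x ∧ Effect y x := by
  obtain ⟨A, B, rfl, rfl⟩ := h
  obtain ⟨C, D, e, rfl⟩ := h'
  have hx := delete_one_cases A B
  have hy := delete_zero_cases C D
  rw [← e] at hy
  generalize A ++ true :: B = x at *
  generalize A ++ B = z at *
  generalize C ++ D = y at *
  simp only [CountChange]
  rcases hy with ⟨a, i1, i2, i3⟩ | ⟨i0, a, a', a''⟩ | ⟨i0, i1⟩ <;>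
  rcases hx with ⟨b, j0, r'⟩ | ⟨j1, b, b', j2, j3⟩ | ⟨j0, j1⟩
  · have := i1.numOcc_eq; have := j0.numOcc_eq
    exact ⟨by omega, by omega, .inr (.inr (.inr (.inr (.inr (.inl
      ⟨by omega, by omega, r'.inner_trans i2 i3⟩)))))⟩
  · have := i1.numOcc_eq; have := j1.numOcc_eq
    exact ⟨by omega, by omega, .inr (.inr (.inl ⟨i1.trans j1, i3.trans j3⟩))⟩
  · have := i1.numOcc_eq; have := j1.numOcc_eq; have := j0.numOcc_eq
    exact ⟨by omega, by omega, .inr (.inl ⟨i1.trans j1, by omega⟩)⟩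
  · have := i0.numOcc_eq; have := j0.numOcc_eq; have := r'.numOcc_w11011_eq
    refine ⟨by omega, by omega, .inr (.inr (.inr (.inr (.inl ⟨i0.trans j0, ?_⟩))))⟩
    rcases a'' with a'' | ⟨b1, b2, b3, b4⟩
    · exact r'.innerDel_or_listDel.imp (fun k => a''.trans k) fun k => .inl (a''.1.trans k)
    · exact .inr (.inr ⟨by omega, by omega, by omega⟩)
  · have := i0.numOcc_eq; have := j1.numOcc_eq; have := j3.numOcc_eq
    refine ⟨by omega, by omega, .inr (.inr (.inr (.inr (.inr (.inr ⟨by omega, by omega, ?_⟩)))))⟩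
    rcases a'' with a'' | ⟨b1, b2, b3, b4⟩
    · exact .inl (a''.trans j3)
    · exact .inr ⟨by omega, by omega, by omega, b4.trans j2⟩
  · have := i0.numOcc_eq; have := j0.numOcc_eq; have := j1.numOcc_eq
    exact ⟨by omega, by omega, .inr (.inr (.inr (.inl ⟨i0.trans j0, by omega⟩)))⟩
  · have := i0.numOcc_eq; have := j0.numOcc_eq; have := i1.numOcc_eq
    exact ⟨by omega, by omega, .inr (.inr (.inr (.inl ⟨i0.trans j0, by omega⟩)))⟩
  · have := i1.numOcc_eq; have := j1.numOcc_eq; have := i0.numOcc_eq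
    exact ⟨by omega, by omega, .inr (.inl ⟨i1.trans j1, by omega⟩)⟩
  · have := i0.numOcc_eq; have := j0.numOcc_eq; have := i1.numOcc_eq; have := j1.numOcc_eq
    exact ⟨by omega, by omega, .inl ⟨i0.trans j0, i1.trans j1⟩⟩

theorem effect_of_mem_deletionBall {x y : Word} (h : y ∈ deletionBall 2 x) :
    CountChange (x.count false - y.count false) w0000 y x ∧
      CountChange (x.count true - y.count true) w1111 y x ∧ Effect y x ∧
      y.count false ≤ x.count false ∧ x.count false ≤ y.count false + 2 := by
  obtain ⟨b, b', z, h1, h2⟩ := exists_deletesTo h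
  have c1 := h1.count false
  have c2 := h2.count false
  have c3 := h1.count true
  have c4 := h2.count true
  cases b <;> cases b' <;> simp only [if_true, if_false, reduceCtorEq] at c1 c2 c3 c4
  · rw [show x.count false - y.count false = 2 by omega,
      show x.count true - y.count true = 0 by omega]
    obtain ⟨e1, e2, e3⟩ := effect_zero_zero h1 h2
    exact ⟨e1, e2, e3, by omega, by omega⟩
  · rw [show x.count false - y.count false = 1 by omega,
      show x.count true - y.count true = 1 by omega]
    obtain ⟨e1, e2, e3⟩ := effect_zero_one h1 h2
    exact ⟨e1, e2, e3, by omega, by omega⟩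
  · rw [show x.count false - y.count false = 1 by omega,
      show x.count true - y.count true = 1 by omega]
    obtain ⟨e1, e2, e3⟩ := effect_one_zero h1 h2
    exact ⟨e1, e2, e3, by omega, by omega⟩
  · rw [show x.count false - y.count false = 0 by omega,
      show x.count true - y.count true = 2 by omega]
    obtain ⟨e1, e2, e3⟩ := effect_one_one h1 h2
    exact ⟨e1, e2, e3, by omega, by omega⟩

/-! ### Comparison of two codewords with a common subword. -/

/-- The substrings delimited by `w` in `x` and `x'` can be decoded from those in `y`. -/
def Decodes (w y x x' : Word) : Prop :=
  ∀ t ≤ 2, ∀ t' ≤ 2, ListDel t (segments w y) (segments w x) →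
    ListDel t' (segments w y) (segments w x') → segments w x = segments w x'

theorem Decodes.eq {w y x x' : Word} (hw : w ≠ []) (hx : x.length = x'.length)
    (h : Decodes w y x x') (h1 : InnerDel 2 w y x) (h2 : InnerDel 2 w y x') : x = x' :=
  eq_of_segments_eq hw hx (h 2 le_rfl 2 le_rfl h1.1 h2.1) (h1.2.symm.trans h2.2)

/-- Decoding would make the segments equal, yet their total length would exceed that of `y` both by
one and by two. -/
theorem Decodes.ne_left {w y x x' : Word} (h : Decodes w y x x')
    (h1 : ListDel 1 (segments w y) (segments w x)) (h2 : InnerDel 2 w y x') : False := by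
  have e := h 1 (by omega) 2 le_rfl h1 h2.1
  have := h1.2
  have := h2.1.2
  rw [e] at *
  omega

theorem Decodes.ne_right {w y x x' : Word} (h : Decodes w y x x')
    (h1 : InnerDel 2 w y x) (h2 : ListDel 1 (segments w y) (segments w x')) : False := by
  have e := h 2 le_rfl 1 (by omega) h1.1 h2
  have := h1.1.2
  have := h2.2
  rw [e] at *
  omega

theorem eq_of_effect {x x' y : Word} (hx : x.length = x'.length)
    (h0 : numOcc w0000 x = numOcc w0000 x') (h1 : numOcc w1111 x = numOcc w1111 x')
    (h2 : numOcc w11011 x ≡ numOcc w11011 x' [MOD 7])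
    (d0 : Decodes w0000 y x x') (d1 : Decodes w1111 y x x') (d2 : Decodes w110011 y x x')
    (d3 : Decodes w11011 y x x') (h : Effect y x) (h' : Effect y x') : x = x' := by
  have E0 := d0.eq (by decide) hx
  have E1 := d1.eq (by decide) hx
  have E2 := d2.eq (by decide) hx
  have E3 := d3.eq (by decide) hx
  have n0 := fun u (k : InnerDel 2 w0000 y u) => k.numOcc_eq
  have n1 := fun u (k : InnerDel 2 w1111 y u) => k.numOcc_eq
  have n3 := fun u (k : InnerDel 2 w11011 y u) => k.numOcc_eq
  have L2 := d2.ne_left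
  have R2 := d2.ne_right
  have L3 := d3.ne_left
  have R3 := d3.ne_right
  unfold Nat.ModEq at h2
  unfold Effect RunDel at h h'
  -- Each pair of alternatives has a commonly preserved marker, a clash of total lengths, or a clash
  -- of counts. For 11011 a congruence suffices, because the recorded changes are 0 or ±1.
  rcases h with ⟨a, b⟩ | ⟨a, b⟩ | ⟨a, b⟩ | ⟨a, b⟩ | ⟨a, b | b | b⟩ |
      ⟨a, b, ⟨c, d⟩ | ⟨c, d⟩ | ⟨c, d⟩⟩ | ⟨a, b, c | ⟨c, c', c'', d⟩⟩ <;>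
    rcases h' with ⟨a', b'⟩ | ⟨a', b'⟩ | ⟨a', b'⟩ | ⟨a', b'⟩ | ⟨a', b' | b' | b'⟩ |
      ⟨a', b', ⟨e, f⟩ | ⟨e, f⟩ | ⟨e, f⟩⟩ | ⟨a', b', e | ⟨e, e', e'', f⟩⟩ <;>
    first
      | exact E0 (by assumption) (by assumption)
      | exact E1 (by assumption) (by assumption)
      | exact E2 (by assumption) (by assumption)
      | exact E3 (by assumption) (by assumption)
      | exact (L2 (by assumption) (by assumption)).elim
      | exact (R2 (by assumption) (by assumption)).elim
      | exact (L3 (by assumption) (by assumption)).elim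
      | exact (R3 (by assumption) (by assumption)).elim
      | (exfalso
         try have k0 := n0 x (by assumption)
         try have k1 := n1 x (by assumption)
         try have k3 := n3 x (by assumption)
         try have l0 := n0 x' (by assumption)
         try have l1 := n1 x' (by assumption)
         try have l3 := n3 x' (by assumption)
         omega)

theorem correctsTwoDeletions_code {q r m n s : ℕ} {g : Word → ZMod q}
    (hg : IsTwoDeletionHash s g) {H : Matrix (Fin r) (Fin m) (ZMod q)}
    (hH : IsDoubleErrorCorrecting H) (hnm : n < m)
    {a0000 a1111 a110011 a11011 : Fin r → ZMod q} {c : Fin 6 → ZMod 7} :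
    CorrectsTwoDeletions (code n s g H a0000 a1111 a110011 a11011 c) := by
  rintro x ⟨⟨hn, l0, l1, l2, l3⟩, c0, c1, c2, c3, -, c5, f0, f1, f2, f3⟩
    x' ⟨⟨hn', l0', l1', l2', l3'⟩, c0', c1', c2', c3', -, c5', f0', f1', f2', f3'⟩ y hy hy'
  have hx : x.length = x'.length := hn.trans hn'.symm
  obtain ⟨e1, e2, e3, e4, e5⟩ := effect_of_mem_deletionBall hy
  obtain ⟨e1', e2', e3', e4', e5'⟩ := effect_of_mem_deletionBall hy'
  have m0 := (ZMod.natCast_eq_natCast_iff' _ _ 7).1 (c0.trans c0'.symm)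
  have m2 := (ZMod.natCast_eq_natCast_iff' _ _ 7).1 (c2.trans c2'.symm)
  have m3 := (ZMod.natCast_eq_natCast_iff' _ _ 7).1 (c3.trans c3'.symm)
  have m5 := (ZMod.natCast_eq_natCast_iff _ _ 7).1 (c5.trans c5'.symm)
  -- Each codeword has between 0 and 2 more zeros than `y`, so the residue modulo 7 decides.
  have k0 : x.count false = x'.count false := by omega
  have k1 : x.count true = x'.count true := by
    have := List.count_false_add_count_true x
    have := List.count_false_add_count_true x'
    omega
  -- Both codewords now share the offset in `CountChange`, whose window has seven values; hence the
  -- congruences become equalities of N_0000 and of N_1111.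
  rw [k0] at e1
  rw [k1] at e2
  simp only [CountChange] at e1 e2 e1' e2'
  refine eq_of_effect hx (by omega) (by omega) m5 ?_ ?_ ?_ ?_ e3 e3' <;> intro t ht t' ht' h h'
  · exact segments_eq_of_listDel hg hH (by decide) (by omega) l0 l0' f0 f0' ht ht' h h'
  · exact segments_eq_of_listDel hg hH (by decide) (by omega) l1 l1' f1 f1' ht ht' h h'
  · exact segments_eq_of_listDel hg hH (by decide) (by omega) l2 l2' f2 f2' ht ht' h h'
  · exact segments_eq_of_listDel hg hH (by decide) (by omega) l3 l3' f3 f3' ht ht' h h'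

end TwoDeletion

theorem mainTheorem1 (n s v q N r : ℕ)
    (h : TwoDeletion.Word → (Fin v → Bool)) (hh : TwoDeletion.IsTwoDeletionHash s h)
    (hq : q.Prime) (hq_odd : Odd q) (hq_card : (h '' {u | u.length ≤ s}).ncard < q)
    (ι : (Fin v → Bool) → ZMod q) (hι : Set.InjOn ι (h '' {u | u.length ≤ s}))
    (hN : 1 ≤ N) (hNn : n < q ^ (N - 1))
    (H : Matrix (Fin r) (Fin (q ^ (N - 1))) (ZMod q))
    (hH : TwoDeletion.IsDoubleErrorCorrecting H)
    (a0000 a1111 a110011 a11011 : Fin r → ZMod q) (c : Fin 6 → ZMod 7) :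
    TwoDeletion.CorrectsTwoDeletions
      (TwoDeletion.code n s (fun u => ι (h u)) H a0000 a1111 a110011 a11011 c) := by
  -- Injectivity of `ι` on the hashes of short words makes `fun u => ι (h u)` a two-deletion hash as
  -- well.
  refine TwoDeletion.correctsTwoDeletions_code (fun u u' z hu hu' hz hz' e => ?_) hH hNn
  exact hh u u' z hu hu' hz hz' (hι ⟨u, hu, rfl⟩ ⟨u', hu', rfl⟩ e)
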